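/- Let $n\ge 0$ be an integer and write $[m]=\{1,\dots,m\}$. Let $B_{m}$ be the group, under composition, of all bijections $\sigma$ of $\{\pm1,\dots,\pm m\}$ onto itself with $\sigma(-k)=-\sigma(k)$ for all $k$, with Coxeter generators $s_0,s_1,\dots,s_{m-1}$, where $s_0$ exchanges $1$ and $-1$ and fixes all other letters, and, for $1\le i\le m-1$, $s_i$ exchanges $i$ with $i+1$ and $-i$ with $-(i+1)$. Let $L_{m}=C_2\wr A_{m}$ be the subgroup of those $\sigma\in B_{m}$ for which the permutation $i\mapsto|\sigma(i)|$ of $[m]$ is even. For $\sigma\in B_{m}$ let - $\operatorname{Neg}(\sigma)=\{i\in[m] : \sigma(i)<0\}$; - $\ell_B(\sigma)$ be the least length of an expression of $\sigma$ as a product of the generators $s_0,\dots,s_{m-1}$; - $\operatorname{del}_B(\sigma)=\#\{2\le j\le m : \sigma(i)>\sigma(j)\text{ for all }1\le i<j\}$; - $\ell_L(\sigma)=\ell_B(\sigma)-\operatorname{del}_B(\sigma)$. Let $a_i=s_1s_{i+1}\in L_{n+1}$ for $1\le i\le n-1$, and for $\pi\in L_{n+1}$ let $$\operatorname{Des}_A(\pi)=\{1\le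 i\le n-1 : \ell_L(\pi a_i)\le \ell_L(\pi)\},\qquad \operatorname{nrmaj}_{L_{n+1}}(\pi)=\sum_{i\in\operatorname{Des}_A(\pi)}(n-i)+\sum_{i\in\operatorname{Neg}(\pi^{-1})}i .$$ Then for every $B\subseteq[n+1]$, as generating functions in an indeterminate $q$, $$\sum_{\substack{\pi\in L_{n+1}\\ \operatorname{Neg}(\pi^{-1})\subseteq B}}q^{\operatorname{nrmaj}_{L_{n+1}}(\pi)}=\sum_{\substack{\pi\in L_{n+1}\\ \operatorname{Neg}(\pi^{-1})\subseteq B}}q^{\ell_L(\pi)}=\prod_{i\in B}(1+q^i)\prod_{i=1}^{n-1}\bigl(1+q+\dots+q^{i-1}+2q^i\bigr),$$ where empty products are equal to $1$. -/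

import Mathlib

/-! Signed permutations of `{±1, …, ±n}`, the group `L_n` of signed even permutations, and the
statistics on these groups. -/

/-- The set `{±1, ±2, …, ±n}`, as a finite set of integers. -/
noncomputable abbrev letters (n : ℕ) : Finset ℤ := (Finset.Icc (-(n : ℤ)) n).erase 0

theorem neg_mem_letters {n : ℕ} {k : ℤ} (hk : k ∈ letters n) : -k ∈ letters n := by
  simp only [letters, Finset.mem_erase, Finset.mem_Icc] at hk ⊢
  omega

/-- The involution `k ↦ -k` of `{±1, …, ±n}`. -/
def negLetter {n : ℕ} (k : letters n) : letters n := ⟨-(k : ℤ), neg_mem_letters k.2⟩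

/-- The hyperoctahedral group `B_n`: the bijections `σ` of `{±1, …, ±n}` onto itself such that
`σ (-k) = -σ k`. The product is composition of maps. -/
def groupB (n : ℕ) : Subgroup (Equiv.Perm (letters n)) where
  carrier := {σ | ∀ k, σ (negLetter k) = negLetter (σ k)}
  mul_mem' := by
    intro σ τ hσ hτ k
    rw [Equiv.Perm.mul_apply, Equiv.Perm.mul_apply, hτ, hσ]
  one_mem' := fun _ => rfl
  inv_mem' := by
    intro σ hσ k
    apply σ.injective
    rw [hσ, ← Equiv.Perm.mul_apply, ← Equiv.Perm.mul_apply, mul_inv_cancel,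
      Equiv.Perm.one_apply, Equiv.Perm.one_apply]

noncomputable instance groupB.decidableMem (n : ℕ) : DecidablePred (· ∈ groupB n) := fun σ =>
  inferInstanceAs (Decidable (∀ k, σ (negLetter k) = negLetter (σ k)))

/-- The integer `σ(k)` for `k ∈ {±1, …, ±n}` (and `k` itself for any other integer `k`). -/
noncomputable def value {n : ℕ} (σ : groupB n) (k : ℤ) : ℤ := Equiv.Perm.ofSubtype (σ : Equiv.Perm (letters n)) k

/-- The set `[n] = {1, …, n}`, as a finite set of integers. -/
noncomputable abbrev posLetters (n : ℕ) : Finset ℤ := Finset.Icc 1 (n : ℤ)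

theorem mem_letters_of_mem_posLetters {n : ℕ} {k : ℤ} (hk : k ∈ posLetters n) :
    k ∈ letters n := by
  simp only [letters, posLetters, Finset.mem_erase, Finset.mem_Icc] at hk ⊢
  omega

theorem abs_mem_posLetters {n : ℕ} {k : ℤ} (hk : k ∈ letters n) : |k| ∈ posLetters n := by
  simp only [letters, posLetters, Finset.mem_erase, Finset.mem_Icc] at hk ⊢
  rcases abs_cases k with h | h <;> omega

/-- The map `i ↦ |σ(i)|` from `[n]` to itself. -/
def absFun {n : ℕ} (σ : groupB n) (i : posLetters n) : posLetters n :=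
  ⟨|(((σ : Equiv.Perm (letters n)) ⟨i, mem_letters_of_mem_posLetters i.2⟩ : letters n) : ℤ)|,
    abs_mem_posLetters (Subtype.property _)⟩

theorem absFun_one {n : ℕ} (i : posLetters n) : absFun (1 : groupB n) i = i := by
  apply Subtype.ext
  have h := (Finset.mem_Icc.mp i.2).1
  exact abs_of_nonneg (zero_le_one.trans h)

theorem absFun_mul {n : ℕ} (σ τ : groupB n) (i : posLetters n) :
    absFun (σ * τ) i = absFun σ (absFun τ i) := by
  apply Subtype.ext
  have key : ∀ k : letters n,
      |(((σ : Equiv.Perm (letters n)) k : letters n) : ℤ)|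
        = |(((σ : Equiv.Perm (letters n))
            ⟨|(k : ℤ)|, mem_letters_of_mem_posLetters (abs_mem_posLetters k.2)⟩ :
              letters n) : ℤ)| := by
    intro k
    rcases abs_choice (k : ℤ) with h | h
    · congr 3
      exact Subtype.ext h.symm
    · have e : (⟨|(k : ℤ)|, mem_letters_of_mem_posLetters (abs_mem_posLetters k.2)⟩ :
          letters n) = negLetter k := Subtype.ext h
      rw [e, σ.2 k]
      exact (abs_neg _).symm
  exact key _

/-- The homomorphism `Abs : B_n → S_n`, `Abs(σ)(i) = |σ(i)|`, onto the symmetric group `S_n`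
of permutations of `[n]`. -/
noncomputable def absB (n : ℕ) : groupB n →* Equiv.Perm (posLetters n) where
  toFun σ :=
    { toFun := absFun σ
      invFun := absFun σ⁻¹
      left_inv := fun i => by rw [← absFun_mul, inv_mul_cancel, absFun_one]
      right_inv := fun i => by rw [← absFun_mul, mul_inv_cancel, absFun_one] }
  map_one' := Equiv.ext absFun_one
  map_mul' σ τ := Equiv.ext (absFun_mul σ τ)

/-- The group `L_n = C_2 ≀ A_n` of signed even permutations: the `σ ∈ B_n` for which the
permutation `i ↦ |σ(i)|` of `[n]` is even. -/
noncomputable def groupL (n : ℕ) : Subgroup (groupB n) := (alternatingGroup (posLetters n)).comap (absB n)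

noncomputable instance groupL.decidableMem (n : ℕ) : DecidablePred (· ∈ groupL n) := fun σ =>
  inferInstanceAs (Decidable (Equiv.Perm.sign (absB n σ) = 1))

/-- The permutation of `ℤ` that induces the Coxeter generator `s_i`: it is the sign change of
`±1` for `i = 0`; for `i ≥ 1` it exchanges `i` with `i + 1` and `-i` with `-(i + 1)`. -/
def adjacentPerm (i : ℕ) : Equiv.Perm ℤ :=
  if i = 0 then Equiv.swap 1 (-1)
  else Equiv.swap (i : ℤ) (i + 1) * Equiv.swap (-(i : ℤ)) (-(i + 1))

theorem adjacentPerm_apply (i : ℕ) (k : ℤ) :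
    adjacentPerm i k =
      if i = 0 then (if k = 1 then -1 else if k = -1 then 1 else k)
      else if k = i then (i : ℤ) + 1
      else if k = i + 1 then (i : ℤ)
      else if k = -i then -((i : ℤ) + 1)
      else if k = -(i + 1) then -(i : ℤ)
      else k := by
  unfold adjacentPerm
  by_cases h : i = 0
  · simp only [h, if_true, Equiv.swap_apply_def]
  · simp only [h, if_false, Equiv.Perm.mul_apply, Equiv.swap_apply_def]
    split_ifs <;> omega

theorem adjacentPerm_mem {n i : ℕ} (hi : i < n) (k : ℤ) :
    adjacentPerm i k ∈ letters n ↔ k ∈ letters n := by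
  rw [adjacentPerm_apply]
  simp only [letters, Finset.mem_erase, Finset.mem_Icc]
  split_ifs <;> omega

theorem adjacentPerm_neg (i : ℕ) (k : ℤ) : adjacentPerm i (-k) = -adjacentPerm i k := by
  rw [adjacentPerm_apply, adjacentPerm_apply]
  split_ifs <;> omega

/-- The Coxeter generators `s_0, s_1, …, s_{n-1}` of `B_n`, where
`s_0 = [-1, 2, …, n]` and `s_i = (i, i + 1)` for `1 ≤ i ≤ n - 1`
(the value for `i ≥ n` is the identity, and is never used). -/
def genS (n : ℕ) (i : ℕ) : groupB n :=
  if hi : i < n then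
    ⟨(adjacentPerm i).subtypePerm (adjacentPerm_mem hi),
      fun k => Subtype.ext (adjacentPerm_neg i k)⟩
  else 1

/-- The `B`-length: the least length of an expression of `σ` as a product of the Coxeter
generators `s_0, …, s_{n-1}`. -/
noncomputable def lengthB {n : ℕ} (σ : groupB n) : ℕ :=
  sInf {r | ∃ w : List (Fin n), w.length = r ∧ (w.map fun i => genS n i).prod = σ}

open Classical in
/-- `del_B(σ)`: the number of `2 ≤ j ≤ n` that are left-to-right minima of `σ`, that is,
`σ(i) > σ(j)` for all `1 ≤ i < j`. -/
noncomputable def delB {n : ℕ} (σ : groupB n) : ℕ :=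
  ((Finset.Icc 2 n).filter fun j : ℕ =>
    ∀ i : ℕ, 1 ≤ i → i < j → value σ (j : ℤ) < value σ (i : ℤ)).card

/-- `Neg(σ) = {i ∈ [n] : σ(i) < 0}`. -/
noncomputable def negSet {n : ℕ} (σ : groupB n) : Finset ℕ :=
  (Finset.Icc 1 n).filter fun i : ℕ => value σ (i : ℤ) < 0

/-- The `L`-length `ℓ_L(σ) = ℓ_B(σ) - del_B(σ)`, as an integer. -/
noncomputable def lengthL {n : ℕ} (σ : groupB n) : ℤ := (lengthB σ : ℤ) - delB σ

/-- The elements `a_i = s_1 s_{i+1}`, `1 ≤ i ≤ n - 1`, in `B_{n+1}`. -/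
noncomputable def genA (n : ℕ) (i : ℕ) : groupB (n + 1) := genS (n + 1) 1 * genS (n + 1) (i + 1)

/-- The `A`-descent set `{1 ≤ i ≤ n - 1 : ℓ_L(π a_i) ≤ ℓ_L(π)}` of `π ∈ L_{n+1}`. -/
noncomputable def desA {n : ℕ} (π : groupL (n + 1)) : Finset ℕ :=
  (Finset.Ico 1 n).filter fun i =>
    lengthL ((π : groupB (n + 1)) * genA n i) ≤ lengthL (π : groupB (n + 1))

/-- The alternating reverse major index of `π ∈ L_{n+1}`: the sum of `n - i` over the
`A`-descents `i` of `π` (all of which satisfy `i < n`). -/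
noncomputable def rmajL {n : ℕ} (π : groupL (n + 1)) : ℕ := ∑ i ∈ desA π, (n - i)

/-- The negative alternating reverse major index of `π ∈ L_{n+1}`. -/
noncomputable def nrmajL {n : ℕ} (π : groupL (n + 1)) : ℕ :=
  rmajL π + ∑ i ∈ negSet (π : groupB (n + 1))⁻¹, i

/-!
Write `σ 1, …, σ m` for the window of `σ ∈ B_m`, where `m = n + 1`, and let `code j` be the number
of entries before `σ j` that exceed it. The Coxeter length is the number of inversions, i.e. the
sum of the code, plus `∑ i` over `i ∈ Neg(σ⁻¹)` (`lengthB_eq_wordLength`). A left-to-right minimum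
in position `j` is a code entry `j - 1`, the largest possible one, so that subtracting `del_B`
truncates the code: `ℓ_L(σ) = ∑ e i + ∑_{i ∈ Neg(σ⁻¹)} i` with `e i = min i (code (i + 2))`,
`0 ≤ i < n` (`lengthL_eq`). The truncated code ignores the order of the first two entries, whence
multiplication by `a_i = s_1 s_{i+1}` changes it in the same way as multiplication by `s_{i+1}`;
comparing two neighbouring entries gives `i ∈ Des_A ↔ e (i - 1) < e i`
(`lengthL_mul_genA_le_iff`). Hence both statistics are the sum of `Neg(π⁻¹)` plus a function of the
truncated code.

The map from `L_{n+1}` to the pairs of a subset `Neg(π⁻¹)` of `[n + 1]` and a sequence of code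
entries in the positions `3, …, n + 1` is a bijection (`encode_bijective`): a window is determined
by its set of letters and its full code, the remaining entry `code 2 ∈ {0, 1}` by parity, and the
two sides have the same size. The truncation `e i = i` has two preimages for `i ≥ 1`. So both
generating functions are `∏ i ∈ B, (1 + q ^ i)` times a sum over the sequences `e` with
`0 ≤ e i ≤ i`, weighted by a factor `2` for each `i ≥ 1` with `e i = i` (`sum_groupL_eq`).

For `q ^ ∑ e i` the weighted sum factors at once. For the major index, every sequence of length
`n + 1` arises from one of length `n` by inserting a `0` and raising all entries behind it by one
(`weightedSum_succ_eq_insertions`); the `n + 1` insertions raise the major index by `0, 1, …, n`,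
each once, and only the insertion in front, which raises it by `n`, creates a new `e i = i`
(`sum_zeroInsertions_pow_ascSum`, `ascSum_zero_cons_map_succ`).
-/

/-! ### Ascents of integer sequences under insertion of a zero -/

/-- The sum, over the positions `i ≥ 1` of the list `e` (numbered from `0`) with
`e (i - 1) < e i`, of the number of entries from position `i` on. -/
def ascSum : List ℕ → ℕ
  | [] => 0
  | [_] => 0
  | a :: b :: l => (if a < b then l.length + 1 else 0) + ascSum (b :: l)

theorem ascSum_map_succ (l : List ℕ) : ascSum (l.map Nat.succ) = ascSum l := by
  induction l with
  | nil => rfl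
  | cons a l ih =>
    cases l with
    | nil => rfl
    | cons b l =>
      simp only [List.map_cons, ascSum, List.length_map, Nat.succ_lt_succ_iff] at ih ⊢
      rw [ih]

theorem ascSum_zero_cons_map_succ (l : List ℕ) :
    ascSum (0 :: l.map Nat.succ) = l.length + ascSum l := by
  cases l with
  | nil => rfl
  | cons b l =>
    have h := ascSum_map_succ (b :: l)
    simp only [List.map_cons] at h ⊢
    rw [ascSum, h]
    simp

theorem ascSum_map_range' (e : ℕ → ℕ) (k s : ℕ) :
    ascSum ((List.range' s (k + 1)).map e) =
      ∑ i ∈ (Finset.Ico (s + 1) (s + k + 1)).filter (fun i => e (i - 1) < e i), (s + k + 1 - i) := by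
  induction k generalizing s with
  | zero => simp [ascSum]
  | succ k ih =>
    have h := ih (s + 1)
    rw [List.range'_succ, List.range'_succ]
    rw [List.range'_succ] at h
    simp only [List.map_cons, ascSum, List.length_map, List.length_range'] at h ⊢
    rw [h, Finset.sum_filter, Finset.sum_filter,
      Finset.sum_eq_sum_Ico_succ_bot (a := s + 1) (b := s + (k + 1) + 1) (by omega)]
    congr 1
    · rw [Nat.add_sub_cancel]
      split_ifs <;> omega
    · rw [show s + 1 + k + 1 = s + (k + 1) + 1 by ring]

/-- The lists obtained from `l` by inserting a new entry `0` at some position other than the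
first one, and adding `1` to all entries behind it. -/
def zeroInsertions : List ℕ → List (List ℕ)
  | [] => []
  | a :: l => ((0 :: l.map Nat.succ) :: zeroInsertions l).map (List.cons a)

theorem zeroInsertions_concat (l : List ℕ) (a : ℕ) :
    zeroInsertions (l ++ [a]) = (zeroInsertions l).map (· ++ [a + 1]) ++ [l ++ [a] ++ [0]] := by
  induction l with
  | nil => rfl
  | cons b l ih =>
    simp only [List.cons_append, zeroInsertions, ih]
    simp [Function.comp_def]

theorem length_of_mem_zeroInsertions {l l' : List ℕ} (h : l' ∈ zeroInsertions l) :
    l'.length = l.length + 1 := by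
  induction l generalizing l' with
  | nil => simp [zeroInsertions] at h
  | cons a l ih =>
    simp only [zeroInsertions, List.map_cons, List.mem_cons, List.mem_map] at h
    rcases h with rfl | ⟨l'', h, rfl⟩
    · simp
    · simp [ih h]

section CommSemiring

variable {R : Type*} [CommSemiring R]

/-- Carlitz's insertion argument: as the position of the inserted zero varies, `ascSum` grows by
each of `0, 1, …, l.length - 1` exactly once. -/
theorem sum_zeroInsertions_pow_ascSum (q : R) (l : List ℕ) :
    ((zeroInsertions l).map fun l' => q ^ ascSum l').sum =
      q ^ ascSum l * ∑ j ∈ Finset.range l.length, q ^ j := by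
  induction l with
  | nil => simp [zeroInsertions]
  | cons a l ih =>
    cases l with
    | nil => simp [zeroInsertions, ascSum]
    | cons b l =>
      -- All insertions behind `b` keep `b` as their head.
      have key : ((zeroInsertions (b :: l)).map fun l' => q ^ ascSum (a :: l')) =
          (zeroInsertions (b :: l)).map fun l' =>
            q ^ (if a < b then l.length + 2 else 0) * q ^ ascSum l' := by
        apply List.map_congr_left
        intro l' hl'
        have hlen := length_of_mem_zeroInsertions hl'
        simp only [zeroInsertions, List.mem_map] at hl'
        obtain ⟨l'', -, rfl⟩ := hl'
        rw [ascSum, pow_add]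
        simp only [List.length_cons] at hlen
        rw [hlen]
      rw [zeroInsertions, List.map_map, List.map_cons, List.sum_cons]
      simp only [Function.comp_def]
      rw [key, List.sum_map_mul_left, ih, ascSum, ascSum_zero_cons_map_succ, ascSum]
      simp only [List.length_cons, Nat.not_lt_zero, if_false, zero_add]
      split_ifs
      · rw [Finset.sum_range_succ' (fun j => q ^ j) (l.length + 1)]
        simp only [pow_add, pow_zero, pow_one, pow_two, mul_add, ← Finset.sum_mul]
        ring
      · rw [Finset.sum_range_succ (fun j => q ^ j) (l.length + 1)]
        ring

/-- The sum of `F` over all lists `0, e 1, …, e k` with `0 ≤ e i ≤ i`, where every `i ≥ 1` with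
`e i = i` contributes a weight `2`. -/
def weightedSum : ℕ → (List ℕ → R) → R
  | 0, F => F [0]
  | k + 1, F => weightedSum k fun l =>
      ∑ a ∈ Finset.range (k + 1), F (l ++ [a]) + 2 * F (l ++ [k + 1])

theorem weightedSum_add (k : ℕ) (F G : List ℕ → R) :
    weightedSum k (fun l => F l + G l) = weightedSum k F + weightedSum k G := by
  induction k generalizing F G with
  | zero => rfl
  | succ k ih =>
    simp only [weightedSum]
    rw [← ih]
    congr 1
    funext l
    rw [Finset.sum_add_distrib]
    ring

theorem weightedSum_mul_right (k : ℕ) (F : List ℕ → R) (c : R) :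
    weightedSum k (fun l => F l * c) = weightedSum k F * c := by
  induction k generalizing F with
  | zero => rfl
  | succ k ih =>
    simp only [weightedSum]
    rw [← ih]
    congr 1
    funext l
    rw [← Finset.sum_mul]
    ring

theorem weightedSum_congr (k : ℕ) {F G : List ℕ → R}
    (h : ∀ l : List ℕ, l.length = k + 1 → F l = G l) : weightedSum k F = weightedSum k G := by
  induction k generalizing F G with
  | zero => exact h _ rfl
  | succ k ih =>
    apply ih
    intro l hl
    have h' : ∀ a, F (l ++ [a]) = G (l ++ [a]) := fun a => h _ (by simp [hl])
    simp only [h']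

theorem weightedSum_eq_sum (k : ℕ) (F : List ℕ → R) :
    weightedSum k F = ∑ d : (i : Fin k) → Fin ((i : ℕ) + 3),
      F (0 :: List.ofFn fun i => min ((i : ℕ) + 1) (d i)) := by
  induction k generalizing F with
  | zero => simp [weightedSum]
  | succ k ih =>
    rw [weightedSum, ih,
      ← (Fin.snocEquiv (fun i : Fin (k + 1) => Fin ((i : ℕ) + 3))).sum_comp,
      Fintype.sum_prod_type_right]
    refine Finset.sum_congr rfl fun d _ => ?_
    have h : ∀ a : Fin (((Fin.last k : Fin (k + 1)) : ℕ) + 3),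
        F (0 :: List.ofFn fun i : Fin (k + 1) => min ((i : ℕ) + 1)
          ((Fin.snocEquiv (fun i : Fin (k + 1) => Fin ((i : ℕ) + 3))) (a, d) i : ℕ)) =
        F ((0 :: List.ofFn fun i => min ((i : ℕ) + 1) (d i)) ++ [min (k + 1) (a : ℕ)]) := by
      intro a
      rw [List.ofFn_succ']
      simp [Fin.snocEquiv]
    simp only [h]
    have h2 := Fin.sum_univ_eq_sum_range (fun a =>
      F ((0 :: List.ofFn fun i => min ((i : ℕ) + 1) (d i)) ++ [min (k + 1) a])) (k + 3)
    refine Eq.trans ?_ h2.symm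
    rw [Finset.sum_range_succ _ (k + 2), Finset.sum_range_succ _ (k + 1),
      min_eq_left (Nat.le_succ _), min_self,
      add_assoc, ← two_mul]
    congr 1
    refine Finset.sum_congr rfl fun a ha => ?_
    rw [min_eq_right (Finset.mem_range.mp ha).le]

/-- Every list counted by `weightedSum (k + 1)` arises exactly once by inserting a zero into a list
counted by `weightedSum k`; the entries `e i = i` survive, and an insertion in front creates a new one. -/
theorem weightedSum_succ_eq_insertions (k : ℕ) (F : List ℕ → R) :
    weightedSum (k + 1) F = weightedSum k fun l =>
      2 * F (0 :: l.map Nat.succ) + ((zeroInsertions l).map F).sum := by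
  induction k generalizing F with
  | zero => simp [weightedSum, zeroInsertions]; ring
  | succ k ih =>
    rw [weightedSum, ih]
    -- Split off the lists that end in `0`, and shift the last entry of the others.
    have h0 := ih fun l => F (l ++ [0])
    have hL : (fun l : List ℕ =>
        2 * (∑ a ∈ Finset.range (k + 2), F ((0 :: l.map Nat.succ) ++ [a]) +
            2 * F ((0 :: l.map Nat.succ) ++ [k + 2])) +
          ((zeroInsertions l).map fun l => ∑ a ∈ Finset.range (k + 2), F (l ++ [a]) +
            2 * F (l ++ [k + 2])).sum) =
        fun l => (2 * F ((0 :: l.map Nat.succ) ++ [0]) +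
            ((zeroInsertions l).map fun l => F (l ++ [0])).sum) +
          (∑ a ∈ Finset.range (k + 1), (2 * F ((0 :: l.map Nat.succ) ++ [a + 1]) +
              ((zeroInsertions l).map fun l => F (l ++ [a + 1])).sum) +
            2 * (2 * F ((0 :: l.map Nat.succ) ++ [k + 2]) +
              ((zeroInsertions l).map fun l => F (l ++ [k + 2])).sum)) := by
      funext l
      simp only [Finset.sum_range_succ' _ (k + 1), List.sum_map_add, List.sum_map_mul_left,
        Finset.sum_add_distrib, ← Finset.mul_sum]
      have hc : ((zeroInsertions l).map fun l =>
          ∑ a ∈ Finset.range (k + 1), F (l ++ [a + 1])).sum =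
          ∑ a ∈ Finset.range (k + 1), ((zeroInsertions l).map fun l => F (l ++ [a + 1])).sum := by
        induction zeroInsertions l with
        | nil => simp
        | cons b t iht => simp [iht, Finset.sum_add_distrib]
      rw [hc]
      ring
    refine (congrArg (weightedSum k) hL).trans ?_
    rw [weightedSum_add, ← h0, weightedSum, ← weightedSum_add, weightedSum]
    congr 1
    funext l
    simp only [zeroInsertions_concat, List.map_append, List.map_map, Function.comp_def,
      List.sum_append, List.map_cons, List.map_nil, List.sum_cons, List.sum_nil, add_zero,
      Finset.sum_add_distrib, List.cons_append, Nat.succ_eq_add_one]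
    ring

theorem weightedSum_pow_ascSum (q : R) (k : ℕ) :
    weightedSum k (fun l => q ^ ascSum l) =
      ∏ i ∈ Finset.Ico 1 (k + 1), (∑ j ∈ Finset.range i, q ^ j + 2 * q ^ i) := by
  induction k with
  | zero => simp [weightedSum, ascSum]
  | succ k ih =>
    rw [weightedSum_succ_eq_insertions, Finset.prod_Ico_succ_top (by omega), ← ih,
      ← weightedSum_mul_right]
    refine weightedSum_congr k fun l hl => ?_
    rw [sum_zeroInsertions_pow_ascSum, ascSum_zero_cons_map_succ, hl]
    ring

theorem weightedSum_pow_sum (q : R) (k : ℕ) :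
    weightedSum k (fun l => q ^ l.sum) =
      ∏ i ∈ Finset.Ico 1 (k + 1), (∑ j ∈ Finset.range i, q ^ j + 2 * q ^ i) := by
  induction k with
  | zero => simp [weightedSum]
  | succ k ih =>
    rw [weightedSum, Finset.prod_Ico_succ_top (by omega), ← ih, ← weightedSum_mul_right]
    congr 1
    funext l
    simp only [List.sum_append, List.sum_singleton, pow_add, ← Finset.mul_sum]
    ring

end CommSemiring

/-! ### Values of signed permutations -/

section Value

variable {m : ℕ}

theorem value_of_mem (σ : groupB m) {k : ℤ} (hk : k ∈ letters m) :
    value σ k = ((σ : Equiv.Perm (letters m)) ⟨k, hk⟩ : letters m) :=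
  Equiv.Perm.ofSubtype_apply_of_mem _ hk

theorem value_of_notMem (σ : groupB m) {k : ℤ} (hk : k ∉ letters m) : value σ k = k :=
  Equiv.Perm.ofSubtype_apply_of_not_mem _ hk

theorem value_one (k : ℤ) : value (1 : groupB m) k = k := by
  simp [value]

theorem value_mul (σ τ : groupB m) (k : ℤ) : value (σ * τ) k = value σ (value τ k) := by
  simp [value]

theorem value_inv_value (σ : groupB m) (k : ℤ) : value σ⁻¹ (value σ k) = k := by
  rw [← value_mul, inv_mul_cancel, value_one]

theorem value_value_inv (σ : groupB m) (k : ℤ) : value σ (value σ⁻¹ k) = k := by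
  rw [← value_mul, mul_inv_cancel, value_one]

theorem value_injective (σ : groupB m) : Function.Injective (value σ) :=
  Equiv.injective _

theorem value_mem_letters (σ : groupB m) {k : ℤ} (hk : k ∈ letters m) :
    value σ k ∈ letters m := by
  rw [value_of_mem σ hk]
  exact Subtype.property _

theorem value_neg (σ : groupB m) (k : ℤ) : value σ (-k) = -value σ k := by
  by_cases hk : k ∈ letters m
  · rw [value_of_mem σ hk, value_of_mem σ (neg_mem_letters hk)]
    exact congrArg Subtype.val (σ.2 ⟨k, hk⟩)
  · have hk' : -k ∉ letters m := fun h => hk (by simpa using neg_mem_letters h)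
    rw [value_of_notMem σ hk, value_of_notMem σ hk']

theorem mem_letters {k : ℤ} : k ∈ letters m ↔ k ≠ 0 ∧ -(m : ℤ) ≤ k ∧ k ≤ m := by
  simp [letters]

theorem natCast_mem_letters {j : ℕ} (h1 : 1 ≤ j) (h2 : j ≤ m) : (j : ℤ) ∈ letters m := by
  rw [mem_letters]
  omega

theorem value_natCast_ne_zero (σ : groupB m) {j : ℕ} (h1 : 1 ≤ j) : value σ j ≠ 0 := by
  intro h
  have h0 : value σ 0 = 0 := value_of_notMem σ (by simp [letters])
  have := value_injective σ (h.trans h0.symm)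
  omega

theorem value_bounds (σ : groupB m) {j : ℕ} (h1 : 1 ≤ j) (h2 : j ≤ m) :
    value σ j ≠ 0 ∧ -(m : ℤ) ≤ value σ j ∧ value σ j ≤ m :=
  mem_letters.mp (value_mem_letters σ (natCast_mem_letters h1 h2))

theorem value_ne_neg_value (σ : groupB m) {i j : ℕ} (hi : 1 ≤ i) :
    value σ i ≠ -value σ j := by
  rw [← value_neg]
  intro h
  have := value_injective σ h
  omega

theorem value_natCast_inj (σ : groupB m) {i j : ℕ} : value σ i = value σ j ↔ i = j := by
  rw [(value_injective σ).eq_iff, Nat.cast_inj]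

theorem groupB_ext {σ τ : groupB m}
    (h : ∀ j ∈ Finset.Icc 1 m, value σ (j : ℕ) = value τ (j : ℕ)) : σ = τ := by
  apply Subtype.ext
  apply Equiv.ext
  intro k
  apply Subtype.ext
  rw [← value_of_mem σ k.2, ← value_of_mem τ k.2]
  have hk := mem_letters.mp k.2
  obtain ⟨j, hj | hj⟩ := Int.eq_nat_or_neg (k : ℤ)
  · rw [hj]
    exact h j (Finset.mem_Icc.mpr (by omega))
  · rw [hj, value_neg, value_neg, h j (Finset.mem_Icc.mpr (by omega))]

/-- The absolute values of `σ 1, …, σ m` exhaust `[m]`. -/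
theorem exists_value_eq_or_neg (σ : groupB m) {a : ℕ} (h1 : 1 ≤ a) (h2 : a ≤ m) :
    ∃ j ∈ Finset.Icc 1 m, (value σ⁻¹ a = (j : ℤ) ∧ value σ (j : ℕ) = a) ∨
      (value σ⁻¹ a = -(j : ℤ) ∧ value σ (j : ℕ) = -a) := by
  have hb := value_bounds σ⁻¹ h1 h2
  have h := value_value_inv σ a
  obtain ⟨j, hj | hj⟩ := Int.eq_nat_or_neg (value σ⁻¹ a)
  · refine ⟨j, Finset.mem_Icc.mpr (by omega), Or.inl ⟨hj, ?_⟩⟩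
    rw [← hj, h]
  · refine ⟨j, Finset.mem_Icc.mpr (by omega), Or.inr ⟨hj, ?_⟩⟩
    rw [hj, value_neg] at h
    omega

theorem mem_negSet {σ : groupB m} {a : ℕ} :
    a ∈ negSet σ ↔ (1 ≤ a ∧ a ≤ m) ∧ value σ a < 0 := by
  simp [negSet]

theorem negSet_subset (σ : groupB m) : negSet σ ⊆ Finset.Icc 1 m :=
  Finset.filter_subset _ _

end Value

/-! ### Inversion codes -/

/-- The number of entries of the word `x 1, x 2, …` that precede `x j` and exceed it. -/
def code (x : ℕ → ℤ) (j : ℕ) : ℕ :=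
  ((Finset.Ico 1 j).filter fun i => x j < x i).card

theorem code_le (x : ℕ → ℤ) (j : ℕ) : code x j ≤ j - 1 := by
  have h := Finset.card_filter_le (Finset.Ico 1 j) fun i => x j < x i
  rwa [Nat.card_Ico] at h

theorem code_eq_iff (x : ℕ → ℤ) (j : ℕ) :
    code x j = j - 1 ↔ ∀ i, 1 ≤ i → i < j → x j < x i := by
  rw [code, ← Nat.card_Ico, Finset.card_filter_eq_iff]
  simp [Finset.mem_Ico]

theorem code_swap_of_lt (x : ℕ → ℤ) {i j : ℕ} (h : j < i) :
    code (x ∘ Equiv.swap i (i + 1)) j = code x j := by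
  unfold code
  congr 1
  refine Finset.filter_congr fun a ha => ?_
  rw [Finset.mem_Ico] at ha
  simp only [Function.comp_apply]
  rw [Equiv.swap_apply_of_ne_of_ne (by omega) (by omega),
    Equiv.swap_apply_of_ne_of_ne (by omega) (by omega)]

theorem code_swap_of_gt (x : ℕ → ℤ) {i j : ℕ} (hi : 1 ≤ i) (h : i + 1 < j) :
    code (x ∘ Equiv.swap i (i + 1)) j = code x j := by
  unfold code
  refine Finset.card_equiv (Equiv.swap i (i + 1)) fun a => ?_
  have hm : Equiv.swap i (i + 1) a ∈ Finset.Ico 1 j ↔ a ∈ Finset.Ico 1 j := by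
    simp only [Finset.mem_Ico, Equiv.swap_apply_def]
    split_ifs <;> omega
  rw [Finset.mem_filter, Finset.mem_filter, hm, Function.comp_apply, Function.comp_apply,
    Equiv.swap_apply_of_ne_of_ne (show j ≠ i by omega) (by omega)]

theorem code_succ (x : ℕ → ℤ) {i : ℕ} (hi : 1 ≤ i) :
    code x (i + 1) = ((Finset.Ico 1 i).filter fun a => x (i + 1) < x a).card +
      if x (i + 1) < x i then 1 else 0 := by
  unfold code
  rw [Nat.Ico_succ_right_eq_insert_Ico hi, Finset.filter_insert]
  split_ifs
  · rw [Finset.card_insert_of_notMem (by simp)]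
  · rfl

theorem code_swap_left (x : ℕ → ℤ) {i : ℕ} (hi : 1 ≤ i) (h : x i < x (i + 1)) :
    code (x ∘ Equiv.swap i (i + 1)) i = code x (i + 1) := by
  rw [code_succ x hi, if_neg h.not_gt, add_zero, code]
  congr 1
  refine Finset.filter_congr fun a ha => ?_
  rw [Finset.mem_Ico] at ha
  rw [Function.comp_apply, Function.comp_apply, Equiv.swap_apply_left,
    Equiv.swap_apply_of_ne_of_ne (by omega) (by omega)]

theorem code_swap_right (x : ℕ → ℤ) {i : ℕ} (hi : 1 ≤ i) (h : x i < x (i + 1)) :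
    code (x ∘ Equiv.swap i (i + 1)) (i + 1) = code x i + 1 := by
  rw [code_succ _ hi, code]
  simp only [Function.comp_apply, Equiv.swap_apply_left, Equiv.swap_apply_right, if_pos h]
  congr 2
  refine Finset.filter_congr fun a ha => ?_
  rw [Finset.mem_Ico] at ha
  rw [Equiv.swap_apply_of_ne_of_ne (by omega) (by omega)]

theorem code_le_code_succ_of_lt (x : ℕ → ℤ) {i : ℕ} (hi : 1 ≤ i) (h : x i < x (i + 1)) :
    code x (i + 1) ≤ code x i := by
  rw [code_succ x hi, if_neg h.not_gt, add_zero]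
  exact Finset.card_le_card
    (Finset.monotone_filter_right _ fun a _ ha => h.trans ha)

theorem comp_swap_comp_swap (x : ℕ → ℤ) (i j : ℕ) :
    (x ∘ Equiv.swap i j) ∘ Equiv.swap i j = x := by
  funext k
  simp

theorem sum_add_eq_of_agree_off_pair {s : Finset ℕ} {f g : ℕ → ℕ} {i j a b : ℕ} (hi : i ∈ s)
    (hj : j ∈ s) (hij : i ≠ j) (h : ∀ k, k ≠ i → k ≠ j → f k = g k)
    (hab : f i + f j + a = g i + g j + b) : ∑ k ∈ s, f k + a = ∑ k ∈ s, g k + b := by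
  have hj' : j ∈ s.erase i := Finset.mem_erase.mpr ⟨hij.symm, hj⟩
  rw [← Finset.add_sum_erase s f hi, ← Finset.add_sum_erase s g hi,
    ← Finset.add_sum_erase _ f hj', ← Finset.add_sum_erase _ g hj']
  have hs : ∑ k ∈ (s.erase i).erase j, f k = ∑ k ∈ (s.erase i).erase j, g k := by
    refine Finset.sum_congr rfl fun k hk => ?_
    simp only [Finset.mem_erase] at hk
    exact h k hk.2.1 hk.1
  omega

theorem sum_code_swap (x : ℕ → ℤ) {i m : ℕ} (hi : 1 ≤ i) (him : i + 1 ≤ m)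
    (h : x i < x (i + 1)) :
    ∑ j ∈ Finset.Icc 1 m, code (x ∘ Equiv.swap i (i + 1)) j =
      ∑ j ∈ Finset.Icc 1 m, code x j + 1 := by
  refine sum_add_eq_of_agree_off_pair (i := i) (j := i + 1) (a := 0)
    (Finset.mem_Icc.mpr (by omega)) (Finset.mem_Icc.mpr (by omega)) (by omega) ?_ ?_
  · intro k h1 h2
    rcases lt_or_gt_of_ne h1 with h1 | h1
    · exact code_swap_of_lt x h1
    · exact code_swap_of_gt x hi (by omega)
  · rw [code_swap_left x hi h, code_swap_right x hi h]
    omega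

/-- The inversion code, shifted by two positions and truncated so that the `i`-th entry is at
most `i`. -/
def cappedCode (x : ℕ → ℤ) (i : ℕ) : ℕ := min i (code x (i + 2))

theorem cappedCode_swap_one (x : ℕ → ℤ) : cappedCode (x ∘ Equiv.swap 1 2) = cappedCode x := by
  funext i
  unfold cappedCode
  rcases Nat.eq_zero_or_pos i with rfl | hi
  · simp
  · rw [code_swap_of_gt x le_rfl (by omega)]

/-- The case of an ascent `x (i + 1) < x (i + 2)`, for the word `x` and for the word with the two
entries exchanged. The sum grows by one, unless `x (i + 2)` is smaller than all entries before
`x (i + 1)`, in which case truncation keeps it the same. -/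
theorem sum_cappedCode_swap_le_iff_of_lt (x : ℕ → ℤ) {n i : ℕ} (hi : 1 ≤ i) (hin : i < n)
    (h : x (i + 1) < x (i + 2)) :
    (∑ k ∈ Finset.range n, cappedCode (x ∘ Equiv.swap (i + 1) (i + 2)) k ≤
      ∑ k ∈ Finset.range n, cappedCode x k ↔ cappedCode x (i - 1) < cappedCode x i) ∧
    (∑ k ∈ Finset.range n, cappedCode x k ≤
      ∑ k ∈ Finset.range n, cappedCode (x ∘ Equiv.swap (i + 1) (i + 2)) k ∧
      cappedCode (x ∘ Equiv.swap (i + 1) (i + 2)) (i - 1) <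
        cappedCode (x ∘ Equiv.swap (i + 1) (i + 2)) i) := by
  have hc1 := code_swap_left x (i := i + 1) (by omega) h
  have hc2 := code_swap_right x (i := i + 1) (by omega) h
  have hle := code_le_code_succ_of_lt x (i := i + 1) (by omega) h
  have hx := code_le x (i + 1)
  have hy := code_le x (i + 2)
  have e1 : i - 1 + 2 = i + 1 := by omega
  have key : ∀ a b, cappedCode (x ∘ Equiv.swap (i + 1) (i + 2)) (i - 1) +
      cappedCode (x ∘ Equiv.swap (i + 1) (i + 2)) i + a =
        cappedCode x (i - 1) + cappedCode x i + b →
      ∑ k ∈ Finset.range n, cappedCode (x ∘ Equiv.swap (i + 1) (i + 2)) k + a =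
      ∑ k ∈ Finset.range n, cappedCode x k + b := by
    intro a b hab
    refine sum_add_eq_of_agree_off_pair (i := i - 1) (j := i)
      (Finset.mem_range.mpr (by omega)) (Finset.mem_range.mpr hin) (by omega) ?_ hab
    intro k h1 h2
    unfold cappedCode
    rcases lt_or_gt_of_ne h2 with h3 | h3
    · rw [code_swap_of_lt x (by omega)]
    · rw [code_swap_of_gt x (by omega) (by omega)]
  have hk := key (cappedCode x (i - 1) + cappedCode x i)
    (cappedCode (x ∘ Equiv.swap (i + 1) (i + 2)) (i - 1) +
      cappedCode (x ∘ Equiv.swap (i + 1) (i + 2)) i) (by omega)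
  simp only [cappedCode, e1] at hk ⊢
  simp only [show i + 1 + 1 = i + 2 from rfl] at hc1 hc2 hle
  rw [hc1, hc2] at hk
  rw [hc1, hc2]
  simp only [cappedCode] at *
  omega

/-- Exchanging the entries in positions `i + 1` and `i + 2` fails to increase the sum of the
truncated code exactly where the truncated code of the original word rises. -/
theorem sum_cappedCode_swap_le_iff (x : ℕ → ℤ) (hx : Function.Injective x) {n i : ℕ}
    (hi : 1 ≤ i) (hin : i < n) :
    ∑ k ∈ Finset.range n, cappedCode (x ∘ Equiv.swap (i + 1) (i + 2)) k ≤
      ∑ k ∈ Finset.range n, cappedCode x k ↔ cappedCode x (i - 1) < cappedCode x i := by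
  rcases lt_or_gt_of_ne (hx.ne (show i + 1 ≠ i + 2 by omega)) with h | h
  · exact (sum_cappedCode_swap_le_iff_of_lt x hi hin h).1
  · have h' := (sum_cappedCode_swap_le_iff_of_lt (x ∘ Equiv.swap (i + 1) (i + 2)) hi hin
      (by simpa using h)).2
    rw [comp_swap_comp_swap] at h'
    exact iff_of_true h'.1 h'.2

open Classical in
theorem sum_cappedCode_add_card (x : ℕ → ℤ) (n : ℕ) :
    ∑ k ∈ Finset.range n, cappedCode x k +
      ((Finset.Icc 2 (n + 1)).filter fun j => ∀ i, 1 ≤ i → i < j → x j < x i).card =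
      ∑ j ∈ Finset.Icc 1 (n + 1), code x j := by
  induction n with
  | zero => simp [code]
  | succ n ih =>
    rw [Finset.sum_range_succ, Finset.sum_Icc_succ_top (by omega), ← ih,
      ← Finset.insert_Icc_right_eq_Icc_add_one (by omega), Finset.filter_insert]
    have h := code_eq_iff x (n + 1 + 1)
    have hle := code_le x (n + 1 + 1)
    have hcap : cappedCode x n = min n (code x (n + 1 + 1)) := rfl
    split_ifs with hc
    · rw [Finset.card_insert_of_notMem (by simp)]
      have := h.mpr hc
      omega
    · have : code x (n + 1 + 1) ≠ n + 1 + 1 - 1 := fun h' => hc (h.mp h')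
      omega

/-- Two words with the same letters and the same inversion code are equal. -/
theorem eqOn_of_code_eq {x y : ℕ → ℤ} (m : ℕ) (hx : Function.Injective x)
    (hy : Function.Injective y)
    (himg : (Finset.Icc 1 m).image x = (Finset.Icc 1 m).image y)
    (hc : ∀ j ∈ Finset.Icc 1 m, code x j = code y j) :
    ∀ j ∈ Finset.Icc 1 m, x j = y j := by
  induction m with
  | zero => simp
  | succ m ih =>
    -- The last code entry counts the letters that exceed the last letter.
    have hcount : ∀ z : ℕ → ℤ, Function.Injective z → code z (m + 1) =
        (((Finset.Icc 1 (m + 1)).image z).filter fun v => z (m + 1) < v).card := by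
      intro z hz
      rw [Finset.filter_image, Finset.card_image_of_injective _ hz, code]
      congr 1
      ext a
      simp only [Finset.mem_filter, Finset.mem_Ico, Finset.mem_Icc]
      refine ⟨fun h => ⟨by omega, h.2⟩, fun h => ⟨?_, h.2⟩⟩
      have : a ≠ m + 1 := by
        rintro rfl
        exact lt_irrefl _ h.2
      omega
    have hmem : ∀ z : ℕ → ℤ, z (m + 1) ∈ (Finset.Icc 1 (m + 1)).image z := fun z =>
      Finset.mem_image_of_mem z (Finset.mem_Icc.mpr (by omega))
    have hstrict : ∀ (S : Finset ℤ) (u v : ℤ), v ∈ S → u < v →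
        (S.filter fun w => v < w).card < (S.filter fun w => u < w).card := by
      intro S u v hv huv
      apply Finset.card_lt_card
      rw [Finset.ssubset_iff_of_subset
        (Finset.monotone_filter_right _ fun w _ hw => huv.trans hw)]
      exact ⟨v, Finset.mem_filter.mpr ⟨hv, huv⟩, by simp⟩
    have hlast : x (m + 1) = y (m + 1) := by
      have h := hc (m + 1) (Finset.mem_Icc.mpr (by omega))
      rw [hcount x hx, hcount y hy, ← himg] at h
      rcases lt_trichotomy (x (m + 1)) (y (m + 1)) with h' | h' | h'
      · exact absurd h (hstrict _ _ _ (himg ▸ hmem y) h').ne'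
      · exact h'
      · exact absurd h (hstrict _ _ _ (hmem x) h').ne
    have himg' : ∀ z : ℕ → ℤ, Function.Injective z → (Finset.Icc 1 m).image z =
        ((Finset.Icc 1 (m + 1)).image z).erase (z (m + 1)) := by
      intro z hz
      rw [← Finset.insert_Icc_right_eq_Icc_add_one (by omega), Finset.image_insert,
        Finset.erase_insert]
      intro h
      obtain ⟨a, ha, h⟩ := Finset.mem_image.mp h
      rw [hz h, Finset.mem_Icc] at ha
      omega
    have hrec := ih (by rw [himg' x hx, himg' y hy, himg, hlast]) fun j hj =>
      hc j (Finset.Icc_subset_Icc_right (Nat.le_succ m) hj)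
    intro j hj
    rw [← Finset.insert_Icc_right_eq_Icc_add_one (by omega), Finset.mem_insert] at hj
    rcases hj with rfl | hj
    · exact hlast
    · exact hrec j hj

/-! ### Length in terms of the word -/

section Length

variable {m : ℕ}

/-- The window notation `σ 1, …, σ m` of a signed permutation, as a sequence of integers. -/
noncomputable def word (σ : groupB m) (j : ℕ) : ℤ := value σ j

theorem word_injective (σ : groupB m) : Function.Injective (word σ) := fun _ _ h =>
  (value_natCast_inj σ).mp h

theorem value_genS {i : ℕ} (hi : i < m) (k : ℤ) : value (genS m i) k = adjacentPerm i k := by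
  by_cases hk : k ∈ letters m
  · rw [value_of_mem _ hk]
    simp [genS, hi]
  · rw [value_of_notMem _ hk, adjacentPerm_apply]
    rw [mem_letters] at hk
    split_ifs <;> omega

theorem adjacentPerm_adjacentPerm (i : ℕ) (k : ℤ) : adjacentPerm i (adjacentPerm i k) = k := by
  have h := adjacentPerm_apply i k
  rw [adjacentPerm_apply i (adjacentPerm i k)]
  split_ifs at h ⊢ <;> omega

theorem genS_mul_self (m i : ℕ) : genS m i * genS m i = 1 := by
  by_cases hi : i < m
  · refine groupB_ext fun j _ => ?_
    rw [value_mul, value_genS hi, value_genS hi, adjacentPerm_adjacentPerm, value_one]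
  · simp [genS, hi]

theorem mul_genS_mul_genS (σ : groupB m) (i : ℕ) : σ * genS m i * genS m i = σ := by
  rw [mul_assoc, genS_mul_self, mul_one]

theorem value_inv_mul_genS (σ : groupB m) {i : ℕ} (hi : i < m) (k : ℤ) :
    value (σ * genS m i)⁻¹ k = adjacentPerm i (value σ⁻¹ k) := by
  rw [mul_inv_rev, value_mul, inv_eq_of_mul_eq_one_left (genS_mul_self m i), value_genS hi]

theorem word_mul_genS (σ : groupB m) {i : ℕ} (hi : 1 ≤ i) (him : i < m) :
    word (σ * genS m i) = word σ ∘ Equiv.swap i (i + 1) := by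
  funext j
  have h : adjacentPerm i (j : ℤ) = ((Equiv.swap i (i + 1) j : ℕ) : ℤ) := by
    rw [adjacentPerm_apply, Equiv.swap_apply_def]
    split_ifs <;> omega
  rw [word, value_mul, value_genS him, h]
  rfl

theorem negSet_inv_mul_genS (σ : groupB m) {i : ℕ} (hi : 1 ≤ i) (him : i < m) :
    negSet (σ * genS m i)⁻¹ = negSet σ⁻¹ := by
  ext a
  rw [mem_negSet, mem_negSet, value_inv_mul_genS σ him, adjacentPerm_apply]
  refine and_congr_right fun _ => ?_
  split_ifs <;> omega

/-- The number of inversions of the window plus the absolute values of its negative entries. -/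
noncomputable def wordLength (σ : groupB m) : ℕ :=
  ∑ j ∈ Finset.Icc 1 m, code (word σ) j + ∑ i ∈ negSet σ⁻¹, i

theorem wordLength_mul_genS_of_lt (σ : groupB m) {i : ℕ} (hi : 1 ≤ i) (him : i < m)
    (h : word σ i < word σ (i + 1)) : wordLength (σ * genS m i) = wordLength σ + 1 := by
  rw [wordLength, wordLength, negSet_inv_mul_genS σ hi him, word_mul_genS σ hi him,
    sum_code_swap _ hi him h]
  omega

/-- For `|σ 1| = a`, exactly the `a - 1` letters below `a` occur, up to sign, among
`σ 2, …, σ m` with smaller absolute value. -/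
theorem card_natAbs_word_lt (σ : groupB m) (hm : 1 ≤ m) :
    ((Finset.Icc 2 m).filter fun j => (word σ j).natAbs < (word σ 1).natAbs).card + 1 =
      (word σ 1).natAbs := by
  have h1 := value_bounds σ le_rfl hm
  have himg : ((Finset.Icc 2 m).filter fun j => (word σ j).natAbs < (word σ 1).natAbs).image
      (fun j => (word σ j).natAbs) = Finset.Ico 1 (word σ 1).natAbs := by
    ext a
    simp only [Finset.mem_image, Finset.mem_filter, Finset.mem_Icc, Finset.mem_Ico]
    constructor
    · rintro ⟨j, ⟨hj, hlt⟩, rfl⟩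
      have : word σ j ≠ 0 := value_natCast_ne_zero σ (by omega)
      omega
    · rintro ⟨ha1, ha2⟩
      simp only [word] at ha2 ⊢
      obtain ⟨j, hj, hv⟩ := exists_value_eq_or_neg σ ha1 (show a ≤ m by omega)
      rw [Finset.mem_Icc] at hj
      have hja : (value σ (j : ℕ)).natAbs = a := by omega
      refine ⟨j, ⟨⟨?_, hj.2⟩, by omega⟩, hja⟩
      by_contra hlt
      have : j = 1 := by omega
      subst this
      omega
  have hinj : Set.InjOn (fun j => (word σ j).natAbs)
      ((Finset.Icc 2 m).filter fun j => (word σ j).natAbs < (word σ 1).natAbs) := by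
    intro i hi j _ hij
    simp only [Finset.coe_filter, Finset.mem_Icc, Set.mem_ofPred_eq] at hi
    have h2 : value σ i ≠ -value σ j := value_ne_neg_value σ (by omega)
    refine (value_natCast_inj σ).mp ?_
    simp only [word] at hij
    omega
  rw [← Finset.card_image_of_injOn hinj, himg, Nat.card_Ico]
  simp only [word] at h1 ⊢
  push_cast at h1 ⊢
  omega

theorem wordLength_mul_genS_zero_of_pos (σ : groupB m) (hm : 0 < m) (h : 0 < word σ 1) :
    wordLength (σ * genS m 0) = wordLength σ + 1 := by
  have hw1 : word (σ * genS m 0) 1 = -word σ 1 := by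
    rw [word, value_mul, value_genS hm, adjacentPerm_apply]
    simp only [if_true, Nat.cast_one]
    rw [value_neg]
    simp [word]
  have hw : ∀ j, 2 ≤ j → word (σ * genS m 0) j = word σ j := by
    intro j hj
    rw [word, value_mul, value_genS hm, adjacentPerm_apply, if_pos rfl, if_neg (by omega),
      if_neg (by omega), word]
  obtain ⟨a, ha⟩ := Int.eq_ofNat_of_zero_le h.le
  have hb : word σ 1 ≤ m := (value_bounds σ le_rfl hm).2.2
  have hinv : value σ⁻¹ a = 1 := by
    rw [← ha, word, value_inv_value]
    rfl
  have hneg : negSet (σ * genS m 0)⁻¹ = insert a (negSet σ⁻¹) := by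
    ext c
    rw [mem_negSet, Finset.mem_insert, mem_negSet, value_inv_mul_genS σ hm, adjacentPerm_apply]
    have h1 : c = a ↔ value σ⁻¹ c = 1 := by
      rw [← hinv, value_natCast_inj]
    have h2 : 1 ≤ c → value σ⁻¹ c ≠ -1 := by
      intro hc
      rw [← hinv]
      exact value_ne_neg_value _ hc
    rw [h1, if_pos rfl]
    have h3 : value σ⁻¹ c = 1 → 1 ≤ c ∧ c ≤ m := by
      rw [← h1]
      omega
    constructor
    · rintro ⟨hc, hlt⟩
      have := h2 hc.1
      split_ifs at hlt <;> omega
    · rintro (h4 | ⟨hc, hlt⟩)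
      · rw [if_pos h4]
        exact ⟨h3 h4, by norm_num⟩
      · have := h2 hc.1
        rw [if_neg (by omega), if_neg this]
        exact ⟨hc, hlt⟩
  have hnot : a ∉ negSet σ⁻¹ := by
    rw [mem_negSet, hinv]
    omega
  have hcode : ∀ j ∈ Finset.Icc 2 m, code (word σ) j = code (word (σ * genS m 0)) j +
      if (word σ j).natAbs < (word σ 1).natAbs then 1 else 0 := by
    intro j hj
    rw [Finset.mem_Icc] at hj
    have e : Finset.Ico 1 j = insert 1 (Finset.Ico 2 j) :=
      (Finset.insert_Ico_add_one_left_eq_Ico (by omega)).symm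
    have hrest : (Finset.Ico 2 j).filter (fun i => word (σ * genS m 0) j < word (σ * genS m 0) i) =
        (Finset.Ico 2 j).filter (fun i => word σ j < word σ i) := by
      refine Finset.filter_congr fun i hi => ?_
      rw [Finset.mem_Ico] at hi
      rw [hw i hi.1, hw j hj.1]
    have hne : word σ j ≠ -word σ 1 := value_ne_neg_value σ (by omega)
    unfold code
    rw [e, Finset.filter_insert, Finset.filter_insert, hrest, hw1, hw j hj.1]
    split_ifs <;> (try rw [Finset.card_insert_of_notMem (by simp)]) <;> omega
  have hsum : ∀ x : ℕ → ℤ, ∑ j ∈ Finset.Icc 1 m, code x j = ∑ j ∈ Finset.Icc 2 m, code x j := by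
    intro x
    rw [← Finset.insert_Icc_add_one_left_eq_Icc (show 1 ≤ m from hm),
      Finset.sum_insert (by simp)]
    simp [code]
  have hcard := card_natAbs_word_lt σ hm
  rw [wordLength, wordLength, hneg, Finset.sum_insert hnot, hsum, hsum,
    Finset.sum_congr rfl hcode, Finset.sum_add_distrib, ← Finset.card_filter]
  omega

theorem wordLength_mul_genS_le (σ : groupB m) {i : ℕ} (hi : i < m) :
    wordLength (σ * genS m i) ≤ wordLength σ + 1 := by
  by_cases hasc : if i = 0 then 0 < word σ 1 else word σ i < word σ (i + 1)
  · split_ifs at hasc with h0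
    · subst h0
      exact (wordLength_mul_genS_zero_of_pos σ hi hasc).le
    · exact (wordLength_mul_genS_of_lt σ (by omega) hi hasc).le
  · suffices h : wordLength (σ * genS m i * genS m i) = wordLength (σ * genS m i) + 1 by
      rw [mul_genS_mul_genS] at h
      omega
    split_ifs at hasc with h0
    · subst h0
      refine wordLength_mul_genS_zero_of_pos _ hi ?_
      have hne : word σ 1 ≠ 0 := value_natCast_ne_zero σ le_rfl
      rw [word, value_mul, value_genS hi, adjacentPerm_apply, if_pos rfl, if_pos Nat.cast_one,
        value_neg]
      simp only [word, Nat.cast_one] at hasc hne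
      omega
    · refine wordLength_mul_genS_of_lt _ (by omega) hi ?_
      rw [word_mul_genS σ (by omega) hi]
      have hne := (word_injective σ).ne (show i ≠ i + 1 by omega)
      simp only [Function.comp_apply, Equiv.swap_apply_left, Equiv.swap_apply_right]
      omega

theorem wordLength_one : wordLength (1 : groupB m) = 0 := by
  have h1 : negSet (1 : groupB m) = ∅ := by
    ext a
    rw [mem_negSet, value_one]
    simp
  have h2 : ∀ j, code (word (1 : groupB m)) j = 0 := by
    intro j
    rw [code, Finset.card_eq_zero, Finset.filter_eq_empty_iff]
    intro i hi
    rw [Finset.mem_Ico] at hi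
    rw [word, word, value_one, value_one]
    omega
  rw [wordLength, inv_one, h1]
  simp [h2]

/-- An increasing window of positive entries is that of the identity, so every `σ ≠ 1` has a
descent. -/
theorem exists_wordLength_mul_genS_lt {σ : groupB m} (hσ : σ ≠ 1) :
    ∃ i < m, wordLength σ = wordLength (σ * genS m i) + 1 := by
  by_contra! hno
  apply hσ
  rcases Nat.eq_zero_or_pos m with rfl | hm
  · exact groupB_ext (by simp)
  have h0 : 0 < word σ 1 := by
    by_contra hneg
    refine hno 0 hm ?_
    rw [← wordLength_mul_genS_zero_of_pos (σ * genS m 0) hm, mul_genS_mul_genS]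
    have hne : word σ 1 ≠ 0 := value_natCast_ne_zero σ le_rfl
    rw [word, value_mul, value_genS hm, adjacentPerm_apply, if_pos rfl, if_pos Nat.cast_one,
      value_neg]
    simp only [word, Nat.cast_one] at hneg hne
    omega
  have hstep : ∀ i, 1 ≤ i → i < m → word σ i < word σ (i + 1) := by
    intro i hi him
    by_contra hneg
    refine hno i him ?_
    rw [← wordLength_mul_genS_of_lt (σ * genS m i) hi him, mul_genS_mul_genS]
    rw [word_mul_genS σ hi him]
    have hne := (word_injective σ).ne (show i ≠ i + 1 by omega)
    simp only [Function.comp_apply, Equiv.swap_apply_left, Equiv.swap_apply_right]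
    omega
  have hlow : ∀ j, 1 ≤ j → j ≤ m → (j : ℤ) ≤ word σ j := by
    intro j hj
    induction j, hj using Nat.le_induction with
    | base => intro _; push_cast; omega
    | succ j hj ih =>
      intro hjm
      have := hstep j hj (by omega)
      have := ih (by omega)
      push_cast
      omega
  have hup : ∀ d j, 1 ≤ j → j + d = m → word σ j ≤ j := by
    intro d
    induction d with
    | zero =>
      intro j hj hjm
      have := (value_bounds σ hj (by omega)).2.2
      rw [word]
      omega
    | succ d ih =>
      intro j hj hjm
      have h1 := ih (j + 1) (by omega) (by omega)
      have h2 := hstep j hj (by omega)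
      push_cast at h1
      omega
  refine groupB_ext fun j hj => ?_
  rw [Finset.mem_Icc] at hj
  rw [value_one]
  exact le_antisymm (hup (m - j) j hj.1 (by omega)) (hlow j hj.1 hj.2)

theorem exists_prod_genS_eq (σ : groupB m) :
    ∃ w : List (Fin m), w.length = wordLength σ ∧ (w.map fun i : Fin m => genS m (i : ℕ)).prod = σ := by
  induction h : wordLength σ generalizing σ with
  | zero =>
    refine ⟨[], rfl, ?_⟩
    by_contra hσ
    obtain ⟨i, _, hi⟩ := exists_wordLength_mul_genS_lt (Ne.symm hσ)
    omega
  | succ r ih =>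
    have hσ : σ ≠ 1 := by
      rintro rfl
      rw [wordLength_one] at h
      omega
    obtain ⟨i, him, hi⟩ := exists_wordLength_mul_genS_lt hσ
    obtain ⟨w, hw, hp⟩ := ih (σ * genS m i) (by omega)
    refine ⟨w ++ [⟨i, him⟩], by simp [hw], ?_⟩
    rw [List.map_append, List.prod_append, hp]
    simp [mul_genS_mul_genS]

theorem wordLength_prod_genS_le (w : List (Fin m)) :
    wordLength (w.map fun i : Fin m => genS m (i : ℕ)).prod ≤ w.length := by
  induction w using List.reverseRecOn with
  | nil => simp [wordLength_one]
  | append_singleton w i ih =>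
    rw [List.map_append, List.prod_append, List.map_singleton, List.prod_singleton]
    have := wordLength_mul_genS_le (w.map fun i : Fin m => genS m (i : ℕ)).prod i.2
    rw [List.length_append, List.length_singleton]
    omega

theorem lengthB_eq_wordLength (σ : groupB m) : lengthB σ = wordLength σ := by
  -- In `lengthB` the word is first coerced to a list of natural numbers, through the list monad.
  have hw : ∀ w : List (Fin m), (List.map (fun i => genS m i) do let a ← w; pure (a : ℕ)) =
      w.map fun i : Fin m => genS m (i : ℕ) := by
    intro w
    simp only [bind, pure, List.map_flatMap, List.map_singleton]
    exact (List.map_eq_flatMap).symm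
  simp only [lengthB, hw]
  refine IsLeast.csInf_eq ⟨exists_prod_genS_eq σ, ?_⟩
  rintro r ⟨w, rfl, rfl⟩
  exact wordLength_prod_genS_le w

end Length

/-! ### Descents and the truncated code -/

section Descents

variable {n : ℕ}

open Classical in
theorem lengthL_eq (σ : groupB (n + 1)) :
    lengthL σ = ((∑ k ∈ Finset.range n, cappedCode (word σ) k + ∑ i ∈ negSet σ⁻¹, i : ℕ) : ℤ) := by
  have h := sum_cappedCode_add_card (word σ) n
  have hd : delB σ = ((Finset.Icc 2 (n + 1)).filter fun j =>
      ∀ i, 1 ≤ i → i < j → word σ j < word σ i).card := by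
    unfold delB
    congr
  rw [lengthL, lengthB_eq_wordLength, wordLength, hd, ← h]
  push_cast
  ring

theorem lengthL_mul_genA_le_iff (σ : groupB (n + 1)) {i : ℕ} (hi : 1 ≤ i) (hin : i < n) :
    lengthL (σ * genA n i) ≤ lengthL σ ↔
      cappedCode (word σ) (i - 1) < cappedCode (word σ) i := by
  have h := sum_cappedCode_swap_le_iff (word σ ∘ Equiv.swap 1 2)
    ((word_injective σ).comp (Equiv.injective _)) hi hin
  rw [lengthL_eq, lengthL_eq, Nat.cast_le, genA, ← mul_assoc,
    negSet_inv_mul_genS _ (by omega) (by omega), negSet_inv_mul_genS _ le_rfl (by omega),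
    word_mul_genS _ (by omega) (by omega), word_mul_genS _ le_rfl (by omega),
    Nat.add_le_add_iff_right]
  rwa [cappedCode_swap_one] at h

/-- The truncated code of the window. The first entry is always `0`, and `n ≤ 1` gives the list
`[0]`. -/
noncomputable def codeList (σ : groupB (n + 1)) : List ℕ :=
  0 :: List.ofFn fun i : Fin (n - 1) => cappedCode (word σ) (i + 1)

theorem codeList_eq_map (σ : groupB (n + 1)) :
    codeList σ = (List.range' 0 (n - 1 + 1)).map (cappedCode (word σ)) := by
  rw [codeList, List.range'_succ, List.map_cons, List.range'_eq_map_range, List.map_map]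
  refine congrArg₂ List.cons (by simp [cappedCode]) ?_
  · rw [List.ofFn_eq_map, ← List.map_coe_finRange_eq_range, List.map_map]
    refine List.map_congr_left fun i _ => ?_
    simp [add_comm]

theorem codeList_sum (σ : groupB (n + 1)) :
    (codeList σ).sum = ∑ k ∈ Finset.range n, cappedCode (word σ) k := by
  rw [codeList, List.sum_cons, List.sum_ofFn,
    Fin.sum_univ_eq_sum_range fun k => cappedCode (word σ) (k + 1)]
  have h0 : cappedCode (word σ) 0 = 0 := by simp [cappedCode]
  cases n with
  | zero => simp
  | succ n => rw [Finset.sum_range_succ', h0, Nat.add_sub_cancel, zero_add, add_zero]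

theorem rmajL_eq_ascSum (π : groupL (n + 1)) :
    rmajL π = ascSum (codeList (π : groupB (n + 1))) := by
  rw [codeList_eq_map, ascSum_map_range', rmajL]
  cases n with
  | zero => simp [desA]
  | succ n =>
    simp only [Nat.add_sub_cancel, zero_add]
    refine Finset.sum_congr ?_ fun _ _ => rfl
    refine Finset.filter_congr fun i hi => ?_
    rw [Finset.mem_Ico] at hi
    exact lengthL_mul_genA_le_iff _ hi.1 hi.2

end Descents

/-! ### Counting signed even permutations -/

section Construction

variable {m : ℕ}

/-- The absolute value of a letter, as an element of `[m]`. -/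
def absLetter (k : letters m) : posLetters m := ⟨|(k : ℤ)|, abs_mem_posLetters k.2⟩

theorem absLetter_negLetter (k : letters m) : absLetter (negLetter k) = absLetter k :=
  Subtype.ext (abs_neg _)

/-- The odd extension to `{±1, …, ±m}` of a permutation of `[m]`. -/
def oddExtension (p : Equiv.Perm (posLetters m)) (k : letters m) : letters m :=
  if 0 < (k : ℤ) then ⟨p (absLetter k), mem_letters_of_mem_posLetters (p (absLetter k)).2⟩
  else ⟨-(p (absLetter k) : ℤ),
    neg_mem_letters (mem_letters_of_mem_posLetters (p (absLetter k)).2)⟩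

theorem coe_oddExtension (p : Equiv.Perm (posLetters m)) (k : letters m) :
    (oddExtension p k : ℤ) = if 0 < (k : ℤ) then (p (absLetter k) : ℤ)
      else -(p (absLetter k) : ℤ) := by
  unfold oddExtension
  split_ifs <;> rfl

theorem posLetters_pos (i : posLetters m) : 0 < (i : ℤ) := by
  have := (Finset.mem_Icc.mp i.2).1
  omega

theorem oddExtension_pos_iff (p : Equiv.Perm (posLetters m)) (k : letters m) :
    0 < (oddExtension p k : ℤ) ↔ 0 < (k : ℤ) := by
  rw [coe_oddExtension]
  have := posLetters_pos (p (absLetter k))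
  split_ifs <;> omega

theorem absLetter_oddExtension (p : Equiv.Perm (posLetters m)) (k : letters m) :
    absLetter (oddExtension p k) = p (absLetter k) := by
  apply Subtype.ext
  change |(oddExtension p k : ℤ)| = _
  rw [coe_oddExtension]
  have := posLetters_pos (p (absLetter k))
  split_ifs
  · exact abs_of_pos this
  · rw [abs_neg, abs_of_pos this]

theorem oddExtension_oddExtension (p r : Equiv.Perm (posLetters m)) (k : letters m) :
    oddExtension p (oddExtension r k) = oddExtension (p * r) k := by
  apply Subtype.ext
  simp only [coe_oddExtension p, coe_oddExtension (p * r), oddExtension_pos_iff,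
    absLetter_oddExtension, Equiv.Perm.mul_apply]

theorem oddExtension_one (k : letters m) : oddExtension 1 k = k := by
  apply Subtype.ext
  rw [coe_oddExtension]
  have h := mem_letters.mp k.2
  simp only [Equiv.Perm.one_apply, absLetter]
  split_ifs with hk
  · exact abs_of_pos hk
  · rw [abs_of_neg (by omega), neg_neg]

/-- The signed permutation without sign changes that induces a given permutation of `[m]`. -/
def ofPerm (p : Equiv.Perm (posLetters m)) : groupB m :=
  ⟨{ toFun := oddExtension p
     invFun := oddExtension p⁻¹
     left_inv := fun k => by rw [oddExtension_oddExtension, inv_mul_cancel, oddExtension_one]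
     right_inv := fun k => by rw [oddExtension_oddExtension, mul_inv_cancel, oddExtension_one] },
    fun k => by
      apply Subtype.ext
      have hk := mem_letters.mp k.2
      have habs := absLetter_negLetter k
      simp only [Equiv.coe_fn_mk, coe_oddExtension, negLetter] at habs ⊢
      rw [habs]
      split_ifs <;> omega⟩

/-- The map that changes the sign of the letters with absolute value in `J`. -/
def flipFun (J : Finset (posLetters m)) (k : letters m) : letters m :=
  if absLetter k ∈ J then negLetter k else k

theorem negLetter_negLetter (k : letters m) : negLetter (negLetter k) = k :=
  Subtype.ext (neg_neg _)

theorem flipFun_flipFun (J : Finset (posLetters m)) (k : letters m) :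
    flipFun J (flipFun J k) = k := by
  by_cases h : absLetter k ∈ J
  · simp [flipFun, h, absLetter_negLetter, negLetter_negLetter]
  · simp [flipFun, h]

/-- The signed permutation that changes the sign of the letters with absolute value in `J`. -/
def ofSigns (J : Finset (posLetters m)) : groupB m :=
  ⟨⟨flipFun J, flipFun J, flipFun_flipFun J, flipFun_flipFun J⟩, fun k => by
    simp only [Equiv.coe_fn_mk, flipFun, absLetter_negLetter]
    split_ifs <;> rfl⟩

theorem absB_ofPerm (p : Equiv.Perm (posLetters m)) : absB m (ofPerm p) = p := by
  apply Equiv.ext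
  intro i
  have hi := posLetters_pos i
  refine (absLetter_oddExtension p ⟨i, mem_letters_of_mem_posLetters i.2⟩).trans ?_
  congr 1
  exact Subtype.ext (abs_of_pos hi)

theorem absB_ofSigns (J : Finset (posLetters m)) : absB m (ofSigns J) = 1 := by
  apply Equiv.ext
  intro i
  have hi := posLetters_pos i
  have h : ∀ k : letters m, absLetter (flipFun J k) = absLetter k := by
    intro k
    unfold flipFun
    split_ifs
    · exact absLetter_negLetter k
    · rfl
  exact (h ⟨i, mem_letters_of_mem_posLetters i.2⟩).trans (Subtype.ext (abs_of_pos hi))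

theorem ofSigns_injective : Function.Injective (ofSigns (m := m)) := by
  intro J K h
  ext i
  have hi := posLetters_pos i
  have key : ∀ J : Finset (posLetters m), i ∈ J ↔
      (((ofSigns J : groupB m) : Equiv.Perm (letters m))
        ⟨i, mem_letters_of_mem_posLetters i.2⟩ : ℤ) < 0 := by
    intro J
    have ha : absLetter ⟨(i : ℤ), mem_letters_of_mem_posLetters i.2⟩ = i :=
      Subtype.ext (abs_of_pos hi)
    change _ ↔ ((flipFun J ⟨(i : ℤ), mem_letters_of_mem_posLetters i.2⟩ : letters m) : ℤ) < 0
    unfold flipFun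
    rw [ha]
    split_ifs with hJ
    · simp only [hJ, true_iff, negLetter]
      omega
    · simp only [hJ, false_iff]
      omega
  rw [key J, key K, h]

/-- Only this lower bound on the order of `L_m` is needed: together with the injectivity of `encode`
it yields the bijection. -/
theorem card_alternatingGroup_mul_le (m : ℕ) :
    Nat.card (alternatingGroup (posLetters m)) * 2 ^ m ≤ Nat.card (groupL m) := by
  have hc : Nat.card (Finset (posLetters m)) = 2 ^ m := by
    rw [Nat.card_eq_fintype_card, Fintype.card_finset, Fintype.card_coe]
    simp
  rw [← hc, ← Nat.card_prod]
  have habs : ∀ (p : Equiv.Perm (posLetters m)) (J : Finset (posLetters m)),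
      absB m (ofSigns J * ofPerm p) = p := by
    intro p J
    rw [map_mul, absB_ofSigns, absB_ofPerm, one_mul]
  let g : alternatingGroup (posLetters m) × Finset (posLetters m) → groupL m := fun a =>
    ⟨ofSigns a.2 * ofPerm (a.1 : Equiv.Perm (posLetters m)), by
      rw [groupL, Subgroup.mem_comap, habs]
      exact a.1.2⟩
  refine Nat.card_le_card_of_injective g ?_
  rintro ⟨p, J⟩ ⟨r, K⟩ h
  have h' : ofSigns J * ofPerm (p : Equiv.Perm (posLetters m)) =
      ofSigns K * ofPerm (r : Equiv.Perm (posLetters m)) := congrArg Subtype.val h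
  have hpr : p = r := by
    apply Subtype.ext
    rw [← habs p J, h', habs]
  subst hpr
  rw [ofSigns_injective (mul_right_cancel h')]

end Construction

/-! ### The code of a signed even permutation -/

section Bijection

variable {m : ℕ}

/-- The entries of the window of `σ` are the letters `v` that are negative exactly if `|v|` lies in
`Neg(σ⁻¹)`. -/
theorem mem_image_word (σ : groupB m) (v : ℤ) :
    v ∈ (Finset.Icc 1 m).image (word σ) ↔
      v ∈ letters m ∧ (v < 0 ↔ v.natAbs ∈ negSet σ⁻¹) := by
  rw [Finset.mem_image]
  have hsign : v ∈ letters m → ((v < 0 ↔ v.natAbs ∈ negSet σ⁻¹) ↔ 0 < value σ⁻¹ v) := by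
    intro hv
    have hv' := mem_letters.mp hv
    have h0 := (mem_letters.mp (value_mem_letters σ⁻¹ hv)).1
    rw [mem_negSet]
    rcases Int.natAbs_eq v with h | h
    · rw [← h]
      omega
    · have h2 : value σ⁻¹ (v.natAbs : ℤ) = -value σ⁻¹ v := by
        rw [← value_neg]
        congr 1
        omega
      rw [h2]
      omega
  constructor
  · rintro ⟨j, hj, rfl⟩
    rw [Finset.mem_Icc] at hj
    have hv := value_mem_letters σ (natCast_mem_letters hj.1 hj.2)
    refine ⟨hv, (hsign hv).mpr ?_⟩
    rw [word, value_inv_value]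
    omega
  · rintro ⟨hv, hs⟩
    rw [hsign hv] at hs
    have hb := mem_letters.mp (value_mem_letters σ⁻¹ hv)
    refine ⟨(value σ⁻¹ v).toNat, Finset.mem_Icc.mpr (by omega), ?_⟩
    rw [word, Int.toNat_of_nonneg hs.le, value_value_inv]

theorem groupB_eq_of_code_eq {σ τ : groupB m} (hneg : negSet σ⁻¹ = negSet τ⁻¹)
    (hc : ∀ j ∈ Finset.Icc 1 m, code (word σ) j = code (word τ) j) : σ = τ := by
  refine groupB_ext (eqOn_of_code_eq m (word_injective σ) (word_injective τ) ?_ hc)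
  ext v
  change v ∈ (Finset.Icc 1 m).image (word σ) ↔ v ∈ (Finset.Icc 1 m).image (word τ)
  rw [mem_image_word, mem_image_word, hneg]

theorem sign_absB_genS_one {n : ℕ} (hn : 1 ≤ n) :
    Equiv.Perm.sign (absB (n + 1) (genS (n + 1) 1)) = -1 := by
  have h1 : (1 : ℤ) ∈ posLetters (n + 1) := Finset.mem_Icc.mpr (by omega)
  have h2 : (2 : ℤ) ∈ posLetters (n + 1) := Finset.mem_Icc.mpr (by omega)
  have h : absB (n + 1) (genS (n + 1) 1) = Equiv.swap ⟨1, h1⟩ ⟨2, h2⟩ := by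
    apply Equiv.ext
    intro i
    apply Subtype.ext
    have hi := posLetters_pos i
    have e : ((absB (n + 1) (genS (n + 1) 1) i : posLetters (n + 1)) : ℤ) =
        |value (genS (n + 1) 1) i| := by
      rw [value_of_mem _ (mem_letters_of_mem_posLetters i.2)]
      rfl
    rw [e, value_genS (by omega), adjacentPerm_apply, Equiv.swap_apply_def]
    simp only [Subtype.ext_iff]
    push_cast
    split_ifs <;> (simp_all; try omega)
  rw [h, Equiv.Perm.sign_swap]
  simp

/-- Two distinct elements of `B_{n+1}` with the same `Neg(σ⁻¹)` that agree in all code entries but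
the second differ by `s_1`, so that only one of them lies in `L_{n+1}`. -/
theorem code_two_not_lt {n : ℕ} (hn : 1 ≤ n) {σ τ : groupB (n + 1)} (hσ : σ ∈ groupL (n + 1))
    (hτ : τ ∈ groupL (n + 1)) (hneg : negSet σ⁻¹ = negSet τ⁻¹)
    (hc : ∀ j, 3 ≤ j → j ≤ n + 1 → code (word σ) j = code (word τ) j) :
    ¬ code (word σ) 2 < code (word τ) 2 := by
  intro hlt
  have hle := code_le (word τ) 2
  have hasc : word σ 1 < word σ (1 + 1) := by
    by_contra hdesc
    have hne := (word_injective σ).ne (show 1 ≠ 1 + 1 by omega)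
    have h2 := code_succ (word σ) (le_refl 1)
    rw [if_pos (by omega)] at h2
    simp only [show 1 + 1 = 2 from rfl] at h2
    omega
  have h1 : ∀ x : ℕ → ℤ, code x 1 = 0 := fun x => by simp [code]
  have heq : σ * genS (n + 1) 1 = τ := by
    refine groupB_eq_of_code_eq ?_ fun j hj => ?_
    · rw [negSet_inv_mul_genS σ le_rfl (by omega), hneg]
    · rw [Finset.mem_Icc] at hj
      rw [word_mul_genS σ le_rfl (by omega)]
      rcases (show j = 1 ∨ j = 1 + 1 ∨ 3 ≤ j by omega) with rfl | rfl | h3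
      · rw [h1, h1]
      · rw [code_swap_right _ le_rfl hasc, h1]
        change 0 + 1 = code (word τ) 2
        omega
      · rw [code_swap_of_gt _ le_rfl (by omega), hc j h3 hj.2]
  have hs := sign_absB_genS_one hn
  rw [groupL, Subgroup.mem_comap, Equiv.Perm.mem_alternatingGroup] at hσ hτ
  rw [← heq, map_mul, map_mul, hσ, hs] at hτ
  exact absurd hτ (by decide)

/-- A signed even permutation is encoded by `Neg(π⁻¹)` and the inversion code of its window from
the third entry on; the second entry is determined by parity. -/
noncomputable def encode {n : ℕ} (π : groupL (n + 1)) :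
    (Finset.Icc 1 (n + 1)).powerset × ((i : Fin (n - 1)) → Fin ((i : ℕ) + 3)) :=
  (⟨negSet (π : groupB (n + 1))⁻¹, Finset.mem_powerset.mpr (negSet_subset _)⟩,
    fun i => ⟨code (word (π : groupB (n + 1))) ((i : ℕ) + 3), by
      have := code_le (word (π : groupB (n + 1))) ((i : ℕ) + 3)
      omega⟩)

theorem encode_injective (n : ℕ) : Function.Injective (encode (n := n)) := by
  rintro ⟨σ, hσ⟩ ⟨τ, hτ⟩ h
  have hneg : negSet σ⁻¹ = negSet τ⁻¹ := congrArg (fun a => (a.1 : Finset ℕ)) h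
  have hc : ∀ j, 3 ≤ j → j ≤ n + 1 → code (word σ) j = code (word τ) j := by
    intro j h3 hj
    have := congrFun (congrArg Prod.snd h) ⟨j - 3, by omega⟩
    simp only [encode, Fin.mk.injEq] at this
    rwa [Nat.sub_add_cancel h3] at this
  apply Subtype.ext
  refine groupB_eq_of_code_eq hneg fun j hj => ?_
  rw [Finset.mem_Icc] at hj
  rcases (show j = 1 ∨ j = 2 ∨ 3 ≤ j by omega) with rfl | rfl | h3
  · simp [code]
  · have h1 := code_two_not_lt (by omega) hσ hτ hneg hc
    have h2 := code_two_not_lt (by omega) hτ hσ hneg.symm fun j h3 hj => (hc j h3 hj).symm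
    change code (word σ) 2 = code (word τ) 2
    omega
  · exact hc j h3 hj.2

theorem two_mul_prod_add_three (k : ℕ) :
    2 * ∏ i : Fin k, ((i : ℕ) + 3) = (k + 2).factorial := by
  induction k with
  | zero => rfl
  | succ k ih =>
    rw [Fin.prod_univ_castSucc, ← mul_assoc]
    simp only [Fin.val_castSucc, Fin.val_last]
    rw [ih, show k + 1 + 2 = (k + 2) + 1 by ring, Nat.factorial_succ (k + 2)]
    ring

theorem encode_bijective (n : ℕ) : Function.Bijective (encode (n := n)) := by
  refine (encode_injective n).bijective_of_nat_card_le ?_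
  refine le_trans ?_ (card_alternatingGroup_mul_le (n + 1))
  have hpow : Nat.card (Finset.Icc 1 (n + 1)).powerset = 2 ^ (n + 1) := by
    rw [Nat.card_eq_fintype_card, Fintype.card_coe, Finset.card_powerset, Nat.card_Icc,
      Nat.add_sub_cancel]
  rw [Nat.card_prod, hpow, mul_comm]
  refine Nat.mul_le_mul_right _ ?_
  rw [Nat.card_pi]
  simp only [Nat.card_fin]
  rcases Nat.eq_zero_or_pos n with rfl | hn
  · exact (Nat.card_pos (α := alternatingGroup (posLetters 1)))
  · have : Nontrivial (posLetters (n + 1)) := by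
      rw [← Fintype.one_lt_card_iff_nontrivial, Fintype.card_coe]
      simp
      omega
    have h := two_mul_nat_card_alternatingGroup (α := posLetters (n + 1))
    rw [Nat.card_perm, Nat.card_eq_fintype_card (α := posLetters (n + 1)), Fintype.card_coe,
      Int.card_Icc, Int.add_sub_cancel, Int.toNat_natCast] at h
    have h2 := two_mul_prod_add_three (n - 1)
    rw [show n - 1 + 2 = n + 1 by omega] at h2
    omega

end Bijection

/-! ### The generating functions -/

theorem prod_one_add_pow_eq_sum {R : Type*} [CommSemiring R] (q : R) (B : Finset ℕ) :
    ∏ i ∈ B, (1 + q ^ i) = ∑ J ∈ B.powerset, q ^ ∑ i ∈ J, i := by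
  rw [Finset.prod_one_add]
  exact Finset.sum_congr rfl fun J _ => Finset.prod_pow_eq_pow_sum J _ q

theorem sum_groupL_eq {R : Type*} [CommSemiring R] (q : R) {n : ℕ} {B : Finset ℕ}
    (hB : B ⊆ Finset.Icc 1 (n + 1)) (F : List ℕ → R) :
    ∑ π ∈ {π : groupL (n + 1) | negSet (π : groupB (n + 1))⁻¹ ⊆ B},
        q ^ (∑ i ∈ negSet (π : groupB (n + 1))⁻¹, i) * F (codeList (π : groupB (n + 1))) =
      (∏ i ∈ B, (1 + q ^ i)) * weightedSum (n - 1) F := by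
  rw [weightedSum_eq_sum, prod_one_add_pow_eq_sum, Finset.sum_mul_sum, ← Finset.sum_product']
  refine Finset.sum_nbij (fun π => (((encode π).1 : Finset ℕ), (encode π).2)) ?_ ?_ ?_ ?_
  · intro π hπ
    simpa [encode] using hπ
  · intro π _ ρ _ h
    rw [Prod.mk.injEq] at h
    exact encode_injective n (Prod.ext (Subtype.ext h.1) h.2)
  · rintro ⟨J, d⟩ hJ
    simp only [Finset.coe_product, Set.mem_prod, Finset.mem_coe, Finset.mem_powerset] at hJ
    obtain ⟨π, hπ⟩ := (encode_bijective n).2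
      (⟨J, Finset.mem_powerset.mpr (hJ.1.trans hB)⟩, d)
    have h1 : negSet (π : groupB (n + 1))⁻¹ = J := congrArg (fun a => (a.1 : Finset ℕ)) hπ
    refine ⟨π, ?_, ?_⟩
    · simpa [h1] using hJ.1
    · simp [hπ]
  · intro π _
    rfl

/-- The identity is one of generating functions in an indeterminate `q`; it is stated in
`ℤ[q, q⁻¹]`, where `LaurentPolynomial.T k` is `q ^ k`. -/
theorem proposition3p1 (n : ℕ) (B : Finset ℕ) (hB : B ⊆ Finset.Icc 1 (n + 1)) :
    (∑ π ∈ {π : groupL (n + 1) | negSet (π : groupB (n + 1))⁻¹ ⊆ B},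
        (LaurentPolynomial.T (nrmajL π : ℤ) : LaurentPolynomial ℤ))
      = ∑ π ∈ {π : groupL (n + 1) | negSet (π : groupB (n + 1))⁻¹ ⊆ B},
        (LaurentPolynomial.T (lengthL (π : groupB (n + 1))) : LaurentPolynomial ℤ) ∧
    (∑ π ∈ {π : groupL (n + 1) | negSet (π : groupB (n + 1))⁻¹ ⊆ B},
        (LaurentPolynomial.T (lengthL (π : groupB (n + 1))) : LaurentPolynomial ℤ))
      = (∏ i ∈ B, (1 + LaurentPolynomial.T (i : ℤ))) *
        ∏ i ∈ Finset.Ico 1 n,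
          ((∑ j ∈ Finset.range i, LaurentPolynomial.T (j : ℤ)) +
            2 * LaurentPolynomial.T (i : ℤ)) := by
  have hT : ∀ k : ℕ, (LaurentPolynomial.T (k : ℤ) : LaurentPolynomial ℤ) =
      LaurentPolynomial.T 1 ^ k := by
    intro k
    rw [LaurentPolynomial.T_pow, mul_one]
  have hlen : ∀ π : groupL (n + 1), lengthL (π : groupB (n + 1)) =
      ((∑ i ∈ negSet (π : groupB (n + 1))⁻¹, i + (codeList (π : groupB (n + 1))).sum : ℕ) : ℤ) := by
    intro π
    rw [lengthL_eq, codeList_sum, add_comm]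
  have hmaj : ∀ π : groupL (n + 1), nrmajL π =
      ∑ i ∈ negSet (π : groupB (n + 1))⁻¹, i + ascSum (codeList (π : groupB (n + 1))) := by
    intro π
    rw [nrmajL, rmajL_eq_ascSum, add_comm]
  have hIco : Finset.Ico 1 (n - 1 + 1) = Finset.Ico 1 n := by
    ext i
    simp only [Finset.mem_Ico]
    omega
  simp only [hlen, hmaj, hT, pow_add]
  rw [sum_groupL_eq _ hB fun l => LaurentPolynomial.T 1 ^ ascSum l,
    sum_groupL_eq _ hB fun l => LaurentPolynomial.T 1 ^ l.sum,
    weightedSum_pow_ascSum, weightedSum_pow_sum, hIco]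
  exact ⟨rfl, rfl⟩
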